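/- A (finite) ribbon graph $G$ is a surface with boundary that is the union of a set $V(G)$ of vertex discs and a set $E(G)$ of edge discs (ribbons), where vertices and edges meet in disjoint line segments, each segment lies on the boundary of exactly one vertex and exactly one edge, and each edge contains exactly two such segments. With $v,e,f,c$ the numbers of vertices, edges, boundary components and connected components, the Euler genus is $\varepsilon(G)=2c(G)-v(G)+e(G)-f(G)$. For $A\subseteq E(G)$, the partial Petrial $G^{\tau(A)}$ is obtained by adding a half-twist to each edge in $A$; the partial dual $G^{\delta(A)}$ is obtained by gluing a disc along each boundary component of the spanning ribbon subgraph $(V(G),A)$ (these discs are the new vertices), removing the interiors of the old vertex discs, and keeping the edge ribbons. For a word $w=w_1\cdots w_n$ in the letters $\delta,\tau$, put $G^{w(A)}=(\cdots(G^{w_n(A)})\cdots)^{w_1(A)}$, so that $w_n$ is applied first. A bouquet is a ribbon graph $B$ with exactly one vertex. A loop of $B$ is non-orientable if together with the vertex disc it forms a Möbius band. The intersection graph $I(B)$ is the simple graph with vertex set $E(B)$ in which two distinct loops are adjacent when their ends alternate along the boundary of the vertex. For a simple graph $G$ and $L\subseteq V(G)$, let $\mathbf A_{(G,L)}$ be the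 matrix over $\mathrm{GF}(2)$ indexed by $V(G)$ whose $(u,v)$ entry is $1$ if $u\ne v$ are adjacent or if $u=v\in L$, and $0$ otherwise. Write $M[F]$ for the principal submatrix of $M$ on the index set $F$, $\operatorname{corank} M=\dim\ker M$, $F^c$ for the complement of $F$ and $\Delta$ for symmetric difference. **Theorem.** Let $B$ be a bouquet with intersection graph $I(B)$, let $S$ be the set of non-orientable loops of $B$, and let $F\subseteq E(B)$. Then $$\begin{aligned} (1)\quad & \varepsilon(B^{\tau(F)})=\operatorname{rank}\mathbf A_{(I(B),S\Delta F)},\\ (2)\quad & \varepsilon(B^{\delta(F)})=\operatorname{rank}\mathbf A_{(I(B),S)}[F]+\operatorname{rank}\mathbf A_{(I(B),S)}[F^c],\\ (3)\quad & \varepsilon(B^{\delta\tau(F)})=\operatorname{rank}\mathbf A_{(I(B),S\Delta F)}[F]+\operatorname{rank}\mathbf A_{(I(B),S)}[F^c],\\ (4)\quad & \varepsilon(B^{\tau\delta(F)})=\operatorname{rank}\mathbf A_{(I(B),S\Delta F)}-\operatorname{corank}\mathbf A_{(I(B),S)}[F],\\ (5)\quad & \varepsilon(B^{\tau\delta\tau(F)})=\operatorname{rank}\mathbf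 A_{(I(B),S)}-\operatorname{corank}\mathbf A_{(I(B),S\Delta F)}[F]. \end{aligned}$$ -/

import Mathlib

/-- A (finite, not necessarily connected or orientable) ribbon graph with edge set `E`, up to
homeomorphism, recorded by its corner points.

Each edge ribbon is a rectangle with four corners; opposite sides of it are the two segments in
which it meets the vertex discs (its *ends*), and the other two are its *free sides*. `X` is the
set of all corners of all ribbons. The boundary of a vertex disc which meets some ribbon is
divided by the corners on it into ends of ribbons and free arcs, alternately. So each corner lies
on exactly one end, one free side and one free vertex arc, and
* `endSeg x` is the other endpoint of the end containing `x`;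
* `side x` is the other endpoint of the free side containing `x`;
* `arc x` is the other endpoint of the free vertex arc containing `x`.

Conversely such data rebuild the surface: glue the ribbons along their ends to discs, one for each
closed curve formed by ends and free arcs. Vertex discs that meet no ribbon carry
no corners, and only their number `isolated` is recorded. -/
structure RibbonGraph (X E : Type*) where
  /-- the ribbon of which `x` is a corner -/
  edge : X → E
  endSeg : X → X
  side : X → X
  arc : X → X
  /-- number of vertex discs that meet no ribbon -/
  isolated : ℕ
  endSeg_endSeg : ∀ x, endSeg (endSeg x) = x
  side_side : ∀ x, side (side x) = x
  arc_arc : ∀ x, arc (arc x) = x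
  endSeg_side : ∀ x, endSeg (side x) = side (endSeg x)
  endSeg_ne : ∀ x, endSeg x ≠ x
  side_ne : ∀ x, side x ≠ x
  arc_ne : ∀ x, arc x ≠ x
  endSeg_ne_side : ∀ x, endSeg x ≠ side x
  edge_endSeg : ∀ x, edge (endSeg x) = edge x
  edge_side : ∀ x, edge (side x) = edge x
  edge_surjective : ∀ e, ∃ x, edge x = e
  /-- a ribbon has no more than the four corners `x`, `endSeg x`, `side x`, `side (endSeg x)` -/
  eq_of_edge_eq : ∀ x y, edge y = edge x →
    y = x ∨ y = endSeg x ∨ y = side x ∨ y = side (endSeg x)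

namespace RibbonGraph

variable {X E : Type*}

/-- The vertex discs: those meeting ribbons correspond to their boundary curves, which run
alternately along ends of ribbons and free vertex arcs. -/
def Vertex (G : RibbonGraph X E) : Type _ :=
  Quot (fun x y : X => y = G.endSeg x ∨ y = G.arc x) ⊕ Fin G.isolated

/-- The boundary components of the surface: they run alternately along free sides of ribbons and
free vertex arcs, or else are the boundaries of isolated vertex discs. -/
def BoundaryComponent (G : RibbonGraph X E) : Type _ :=
  Quot (fun x y : X => y = G.side x ∨ y = G.arc x) ⊕ Fin G.isolated

/-- The connected components of the surface. -/
def Component (G : RibbonGraph X E) : Type _ :=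
  Quot (fun x y : X => y = G.endSeg x ∨ y = G.side x ∨ y = G.arc x) ⊕ Fin G.isolated

/-- Euler characteristic `v(G) - e(G) + f(G)`. -/
noncomputable def eulerChar (G : RibbonGraph X E) : ℤ :=
  (Nat.card G.Vertex : ℤ) - (Nat.card E : ℤ) + (Nat.card G.BoundaryComponent : ℤ)

/-- Euler genus `2 c(G) - χ(G)`. -/
noncomputable def eulerGenus (G : RibbonGraph X E) : ℤ :=
  2 * (Nat.card G.Component : ℤ) - G.eulerChar

/-- A bouquet is a ribbon graph with exactly one vertex. -/
def IsBouquet (G : RibbonGraph X E) : Prop :=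
  Nat.card G.Vertex = 1

/-- The partial Petrial: a half-twist is added to each ribbon in `A`, so that each free side of it
now joins a corner on one end to the other corner on the other end. -/
def partialPetrial [DecidableEq E] (G : RibbonGraph X E) (A : Finset E) : RibbonGraph X E where
  edge := G.edge
  endSeg := G.endSeg
  side x := if G.edge x ∈ A then G.side (G.endSeg x) else G.side x
  arc := G.arc
  isolated := G.isolated
  endSeg_endSeg := G.endSeg_endSeg
  side_side x := by
    by_cases h : G.edge x ∈ A
    · simp [h, G.edge_side, G.edge_endSeg, G.endSeg_side, G.side_side, G.endSeg_endSeg]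
    · simp [h, G.edge_side, G.side_side]
  arc_arc := G.arc_arc
  endSeg_side x := by
    by_cases h : G.edge x ∈ A <;> simp [h, G.edge_endSeg, G.endSeg_side]
  endSeg_ne := G.endSeg_ne
  side_ne x := by
    by_cases h : G.edge x ∈ A
    · simp only [h, if_true]
      intro h'
      exact G.endSeg_ne_side x (by rw [← G.side_side (G.endSeg x), h'])
    · simpa [h] using G.side_ne x
  arc_ne := G.arc_ne
  endSeg_ne_side x := by
    by_cases h : G.edge x ∈ A
    · simpa [h] using (G.side_ne (G.endSeg x)).symm
    · simpa [h] using G.endSeg_ne_side x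
  edge_endSeg := G.edge_endSeg
  edge_side x := by
    by_cases h : G.edge x ∈ A <;> simp [h, G.edge_side, G.edge_endSeg]
  edge_surjective := G.edge_surjective
  eq_of_edge_eq x y hxy := by
    have := G.eq_of_edge_eq x y hxy
    by_cases h : G.edge x ∈ A
    · simp only [h, if_true, G.edge_endSeg, G.endSeg_endSeg]
      tauto
    · simpa [h, G.edge_endSeg] using this

/-- The partial dual. A boundary component of the spanning ribbon subgraph with edge set `A` runs
along free vertex arcs, along the free sides of ribbons in `A`, and along the ends of ribbons not
in `A`. These curves bound the new vertex discs, and the ribbons are kept. So a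
ribbon in `A` now meets the vertex discs in its former free sides, and its former ends are free. -/
def partialDual [DecidableEq E] (G : RibbonGraph X E) (A : Finset E) : RibbonGraph X E where
  edge := G.edge
  endSeg x := if G.edge x ∈ A then G.side x else G.endSeg x
  side x := if G.edge x ∈ A then G.endSeg x else G.side x
  arc := G.arc
  isolated := G.isolated
  endSeg_endSeg x := by
    by_cases h : G.edge x ∈ A <;>
      simp [h, G.edge_side, G.edge_endSeg, G.side_side, G.endSeg_endSeg]
  side_side x := by
    by_cases h : G.edge x ∈ A <;>
      simp [h, G.edge_side, G.edge_endSeg, G.side_side, G.endSeg_endSeg]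
  arc_arc := G.arc_arc
  endSeg_side x := by
    by_cases h : G.edge x ∈ A <;> simp [h, G.edge_side, G.edge_endSeg, G.endSeg_side]
  endSeg_ne x := by
    by_cases h : G.edge x ∈ A
    · simpa [h] using G.side_ne x
    · simpa [h] using G.endSeg_ne x
  side_ne x := by
    by_cases h : G.edge x ∈ A
    · simpa [h] using G.endSeg_ne x
    · simpa [h] using G.side_ne x
  arc_ne := G.arc_ne
  endSeg_ne_side x := by
    by_cases h : G.edge x ∈ A
    · simpa [h] using (G.endSeg_ne_side x).symm
    · simpa [h] using G.endSeg_ne_side x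
  edge_endSeg x := by
    by_cases h : G.edge x ∈ A <;> simp [h, G.edge_side, G.edge_endSeg]
  edge_side x := by
    by_cases h : G.edge x ∈ A <;> simp [h, G.edge_side, G.edge_endSeg]
  edge_surjective := G.edge_surjective
  eq_of_edge_eq x y hxy := by
    have := G.eq_of_edge_eq x y hxy
    by_cases h : G.edge x ∈ A
    · simp only [h, if_true, G.edge_side, G.endSeg_side]
      tauto
    · simpa [h, G.edge_endSeg] using this

/-- The two letters of operator words: `δ` for the dual, `τ` for the Petrial. -/
inductive TwualLetter where
  | δ
  | τ

/-- The partial twual `G^{w(A)}` of an operator word `w = w₁ w₂ ⋯ wₙ`: the last letter `wₙ` is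
applied first and `w₁` last, each to the same edge set `A`. -/
def twual [DecidableEq E] (G : RibbonGraph X E) : List TwualLetter → Finset E → RibbonGraph X E
  | [], _ => G
  | TwualLetter.δ :: w, A => (G.twual w A).partialDual A
  | TwualLetter.τ :: w, A => (G.twual w A).partialPetrial A

/-- Travelling along the boundary of a vertex disc: cross the end of a ribbon starting at the
corner `x`, then follow the free arc to the first corner of the next end. The iterates run once
through the ends at the vertex, in their cyclic order, each represented by the corner at
which it is entered; starting at `endSeg x` instead reverses the direction of travel. -/
def next (G : RibbonGraph X E) (x : X) : X :=
  G.arc (G.endSeg x)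

/-- `e` is a non-orientable loop: a direction of travel along the boundary of its vertex disc
enters the two ends of the ribbon `e` at the two endpoints of one free side of `e`, so the ribbon
and the disc form a Möbius band. (For an orientable loop, and the same direction of travel, a free
side joins the corner where one end is entered to the corner where the other is left.) -/
def IsNonorientableLoop (G : RibbonGraph X E) (e : E) : Prop :=
  ∃ x, G.edge x = e ∧ ∃ k : ℕ, G.next^[k] x = G.side x

/-- The ends of `e` and `f` are met in the alternating order `e, f, e, f` in one turn
around a vertex disc. -/
def Interlaced (G : RibbonGraph X E) (e f : E) : Prop :=
  ∃ (x : X) (i j k : ℕ), 0 < i ∧ i < j ∧ j < k ∧ k < Function.minimalPeriod G.next x ∧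
    G.edge x = e ∧ G.edge (G.next^[i] x) = f ∧
    G.edge (G.next^[j] x) = e ∧ G.edge (G.next^[k] x) = f

theorem Interlaced.symm {G : RibbonGraph X E} {e f : E} (h : G.Interlaced e f) :
    G.Interlaced f e := by
  obtain ⟨x, i, j, k, hi, hij, hjk, hk, hx, h1, h2, h3⟩ := h
  have hp : x ∈ Function.periodicPts G.next :=
    Function.minimalPeriod_pos_iff_mem_periodicPts.1 (by omega)
  have key : ∀ m, i ≤ m → G.next^[m - i] (G.next^[i] x) = G.next^[m] x := fun m hm => by
    rw [← Function.iterate_add_apply, Nat.sub_add_cancel hm]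
  refine ⟨G.next^[i] x, j - i, k - i, Function.minimalPeriod G.next x - i, by omega, by omega,
    by omega, ?_, h1, ?_, ?_, ?_⟩
  · rw [Function.minimalPeriod_apply_iterate hp]
    omega
  · rw [key j (by omega), h2]
  · rw [key k (by omega), h3]
  · rw [key _ (by omega), Function.iterate_minimalPeriod, hx]

/-- The intersection graph of a bouquet: the vertices are the loops, and two distinct loops are
adjacent when they are interlaced. -/
def intersectionGraph (G : RibbonGraph X E) : SimpleGraph E where
  Adj e f := e ≠ f ∧ G.Interlaced e f
  symm := ⟨fun _ _ h => ⟨h.1.symm, h.2.symm⟩⟩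
  loopless := ⟨fun _ h => h.1 rfl⟩

end RibbonGraph

open Classical in
/-- The adjacency matrix over `GF(2)` of the graft `(G, L)`. -/
noncomputable def graftMatrix {V : Type*} (G : SimpleGraph V) (L : Set V) :
    Matrix V V (ZMod 2) :=
  Matrix.of fun u v => if (u ≠ v ∧ G.Adj u v) ∨ (u = v ∧ u ∈ L) then 1 else 0

/-- The principal submatrix `M[F]`. -/
def principalSubmatrix {V R : Type*} (M : Matrix V V R) (F : Finset V) : Matrix F F R :=
  M.submatrix Subtype.val Subtype.val

/-- The corank of a square matrix: the dimension of its kernel. -/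
noncomputable def corank {V R : Type*} [Fintype V] [CommRing R] (M : Matrix V V R) : ℕ :=
  Module.finrank R (LinearMap.ker M.mulVecLin)

/-! In every partial twual of `B` the vertex discs and the boundary components are the closed curves
formed by the free arcs and a `pairing`: at ribbons of some `F` it follows free sides, half-twisted
on `C`, and elsewhere it crosses ends. As the twual stays connected, the Euler genus follows from
two curve counts.

Curves are counted by `ZMod 2`-valued functions on the corners that are constant on them; `n` curves
carry `2 ^ n` such functions. Each of these is a potential: constant on free arcs, jumping by some
`y e` across either end of `e`. On a bouquet every `y` is realised, since each ribbon is met twice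
in one turn and the jumps cancel, and the potential is unique up to a constant. Its change along a
free side of `e` is `(A y) e`, with `A` the interlacement matrix (`IsPotential.add_side`); a
half-twist adds `y e`, a diagonal entry. Hence constancy on the curves means that `y` vanishes off
`F` and lies in the kernel of the principal submatrix on `F`, so the count is corank plus one
(`IsBouquet.curveCount_pairing`). -/

open Function

/-! ### Walking around the vertex boundary -/

namespace RibbonGraph

variable {X E : Type*} (G : RibbonGraph X E)

theorem next_injective : Injective G.next :=
  (Involutive.injective G.arc_arc).comp (Involutive.injective G.endSeg_endSeg)

theorem arc_next (x : X) : G.arc (G.next x) = G.endSeg x :=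
  G.arc_arc _

/-- `endSeg` reverses the direction of travel, so a walk from `x` to `endSeg x` would be its own
reverse. Dropping its first and last steps leaves a shorter walk of the same kind, down to a fixed
point of `endSeg` or `arc`. -/
theorem endSeg_iterate_next_ne (k : ℕ) (x : X) : G.endSeg (G.next^[k] x) ≠ x := by
  induction k using Nat.twoStepInduction generalizing x with
  | zero => exact G.endSeg_ne x
  | one =>
    intro h
    apply G.arc_ne (G.endSeg x)
    rw [← G.endSeg_endSeg (G.arc _)]
    exact congrArg G.endSeg h
  | more k ih _ =>
    intro h
    apply ih (G.next x)
    have h' : G.next (G.next^[k] (G.next x)) = G.endSeg x := by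
      rw [← iterate_succ_apply' G.next, ← iterate_succ_apply, ← G.endSeg_endSeg (G.next^[_] x), h]
    rw [← G.arc_next, h']
    rfl

theorem endSeg_iterate_ne_iterate (i k : ℕ) (x : X) :
    G.endSeg (G.next^[k] x) ≠ G.next^[i] x := by
  rcases le_total i k with h | h
  · obtain ⟨d, rfl⟩ := Nat.exists_eq_add_of_le' h
    rw [iterate_add_apply]
    exact G.endSeg_iterate_next_ne _ _
  · obtain ⟨d, rfl⟩ := Nat.exists_eq_add_of_le' h
    rw [iterate_add_apply]
    intro h'
    apply G.endSeg_iterate_next_ne d (G.next^[k] x)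
    rw [← h', G.endSeg_endSeg]

theorem arc_iterate_ne_iterate (i k : ℕ) (x : X) :
    G.arc (G.next^[k] x) ≠ G.next^[i] x := by
  rcases k with _ | k
  · rcases i with _ | i
    · exact G.arc_ne x
    · intro h
      apply G.endSeg_iterate_ne_iterate 0 i x
      rw [← G.arc_next, ← iterate_succ_apply' G.next, ← h, G.arc_arc]
  · rw [iterate_succ_apply', G.arc_next]
    exact G.endSeg_iterate_ne_iterate i k x

theorem edge_cases {x y : X} (h : G.edge y = G.edge x) :
    (y = x ∨ y = G.endSeg x) ∨ (y = G.side x ∨ y = G.endSeg (G.side x)) := by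
  rw [G.endSeg_side]
  rcases G.eq_of_edge_eq x y h with h | h | h | h <;> simp [h]

/-- One direction of travel enters a given ribbon at most twice in one turn. -/
theorem eq_of_edge_iterate_eq {x : X} {i j k : ℕ}
    (hj : G.edge (G.next^[j] x) = G.edge (G.next^[i] x))
    (hk : G.edge (G.next^[k] x) = G.edge (G.next^[i] x)) :
    G.next^[j] x = G.next^[i] x ∨ G.next^[k] x = G.next^[i] x ∨
      G.next^[j] x = G.next^[k] x := by
  -- Each of the two ends of a ribbon contains at most one corner of the orbit, so two of the three
  -- visits agree.
  have key := fun i k => G.endSeg_iterate_ne_iterate i k x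
  rcases G.edge_cases hj with (h | h) | h
  · exact .inl h
  · exact absurd h.symm (key _ _)
  rcases G.edge_cases hk with (h' | h') | h'
  · exact .inr (.inl h')
  · exact absurd h'.symm (key _ _)
  rcases h with h | h <;> rcases h' with h' | h'
  · exact .inr (.inr (h.trans h'.symm))
  · exact absurd (h' ▸ h ▸ rfl) (key k j)
  · exact absurd (h' ▸ h ▸ rfl) (key j k)
  · exact .inr (.inr (h.trans h'.symm))

/-- Every corner lies on the vertex boundary traversed from any other corner. -/
def Transitive : Prop :=
  ∀ x z : X, ∃ k, z = G.next^[k] x ∨ z = G.arc (G.next^[k] x)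

section Finite

variable [Finite X]

theorem minimalPeriod_next_pos (x : X) : 0 < minimalPeriod G.next x :=
  minimalPeriod_pos_of_mem_periodicPts (G.next_injective.mem_periodicPts x)

/-- `endSeg ∘ arc` is the inverse of `next`, and by periodicity that inverse acts as a forward
iterate. -/
theorem exists_endSeg_arc_iterate (k : ℕ) (x : X) :
    ∃ l, G.next^[l] x = G.endSeg (G.arc (G.next^[k] x)) := by
  obtain ⟨m, hm⟩ := Nat.exists_eq_add_of_lt (G.minimalPeriod_next_pos x)
  refine ⟨k + m, ?_⟩
  have : G.next^[k] x = G.next (G.next^[k + m] x) := by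
    rw [← iterate_succ_apply' G.next, show (k + m).succ = k + minimalPeriod G.next x by omega,
      iterate_add_apply, iterate_minimalPeriod]
  rw [this, G.arc_next, G.endSeg_endSeg]

theorem transitive_of_isBouquet (hG : G.IsBouquet) : G.Transitive := by
  intro x z
  -- The set of corners reached is closed under `endSeg` and `arc`, so it descends to the quotient
  -- of vertices, which has a single class.
  let P : X → Prop := fun z => ∃ k, z = G.next^[k] x ∨ z = G.arc (G.next^[k] x)
  have harc : ∀ z, P z → P (G.arc z) := by
    rintro z ⟨k, rfl | rfl⟩
    · exact ⟨k, .inr rfl⟩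
    · exact ⟨k, .inl (G.arc_arc _)⟩
  have hend : ∀ z, P z → P (G.endSeg z) := by
    rintro z ⟨k, rfl | rfl⟩
    · exact ⟨k + 1, .inr (by rw [iterate_succ_apply', G.arc_next])⟩
    · exact (G.exists_endSeg_arc_iterate k x).imp fun l h => .inl h.symm
  have hinv : ∀ y z, z = G.endSeg y ∨ z = G.arc y → P y = P z := by
    rintro y z (rfl | rfl)
    · exact propext ⟨hend y, fun h => G.endSeg_endSeg y ▸ hend _ h⟩
    · exact propext ⟨harc y, fun h => G.arc_arc y ▸ harc _ h⟩
  have hsub : Subsingleton G.Vertex := (Nat.card_eq_one_iff_unique.1 hG).1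
  have h := Sum.inl_injective (hsub.elim (Sum.inl (Quot.mk _ x) : G.Vertex)
    (Sum.inl (Quot.mk _ z)))
  exact (congrArg (Quot.lift P hinv) h).mp ⟨0, .inl rfl⟩

variable {G}

theorem Transitive.exists_lt (hG : G.Transitive) (x z : X) :
    ∃ k < minimalPeriod G.next x, z = G.next^[k] x ∨ z = G.arc (G.next^[k] x) := by
  obtain ⟨k, hk⟩ := hG x z
  refine ⟨k % minimalPeriod G.next x, Nat.mod_lt _ (G.minimalPeriod_next_pos x), ?_⟩
  rwa [iterate_mod_minimalPeriod_eq]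

/-- One direction of travel enters every ribbon a second time. -/
theorem Transitive.exists_opposite (hG : G.Transitive) (x : X) :
    ∃ k, 0 < k ∧ k < minimalPeriod G.next x ∧
      (G.next^[k] x = G.side x ∨ G.next^[k] x = G.endSeg (G.side x)) := by
  have : ∃ k, G.next^[k] x = G.side x ∨ G.next^[k] x = G.endSeg (G.side x) := by
    obtain ⟨k, hk | hk⟩ := hG x (G.side x)
    · exact ⟨k, .inl hk.symm⟩
    -- A walk that leaves an end at `side x` has entered it at `endSeg (side x)`.
    · exact hk ▸ (G.exists_endSeg_arc_iterate k x).imp fun l h => .inr h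
  obtain ⟨k, hk⟩ := this
  rw [← iterate_mod_minimalPeriod_eq (f := G.next) (n := k)] at hk
  refine ⟨_, Nat.pos_of_ne_zero fun h => ?_, Nat.mod_lt _ (G.minimalPeriod_next_pos x), hk⟩
  rw [h] at hk
  rcases hk with hk | hk
  · exact G.side_ne x hk.symm
  · apply G.endSeg_ne_side x
    rw [show x = _ from hk, G.endSeg_endSeg, ← show x = _ from hk]

end Finite

end RibbonGraph

/-! ### Potentials and the interlacement matrix -/

namespace RibbonGraph

variable {X E : Type*} (G : RibbonGraph X E)

/-- `φ` is constant along the free arcs, and crossing an end of the ribbon `e` changes it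
by `y e`. -/
def IsPotential (φ : X → ZMod 2) (y : E → ZMod 2) : Prop :=
  (∀ x, φ (G.arc x) = φ x) ∧ ∀ x, φ (G.endSeg x) = φ x + y (G.edge x)

variable {G}

namespace IsPotential

variable {φ ψ : X → ZMod 2} {y z : E → ZMod 2}

theorem sub (h : G.IsPotential φ y) (h' : G.IsPotential ψ z) :
    G.IsPotential (φ - ψ) (y - z) := by
  refine ⟨fun x => by simp [h.1, h'.1], fun x => ?_⟩
  simp only [Pi.sub_apply, h.2, h'.2]
  ring

theorem sum_smul [Fintype E] {φ : E → X → ZMod 2} {z : E → E → ZMod 2}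
    (h : ∀ e, G.IsPotential (φ e) (z e)) (y : E → ZMod 2) :
    G.IsPotential (∑ e, y e • φ e) (∑ e, y e • z e) := by
  refine ⟨fun x => by simp [(h _).1], fun x => ?_⟩
  simp [(h _).2, mul_add, Finset.sum_add_distrib]

theorem iterate (h : G.IsPotential φ y) (k : ℕ) (x : X) :
    φ (G.next^[k] x) = φ x + ∑ s ∈ Finset.range k, y (G.edge (G.next^[s] x)) := by
  induction k with
  | zero => simp
  | succ k ih => rw [iterate_succ_apply', next, h.1, h.2, ih, Finset.sum_range_succ, add_assoc]

theorem eq_of_zero (hG : G.Transitive) (h : G.IsPotential φ 0) (x z : X) : φ z = φ x := by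
  obtain ⟨k, rfl | rfl⟩ := hG x z <;> simp [h.1, h.iterate]

/-- Passing to the opposite free side crosses both ends of the ribbon, and the two jumps cancel mod
2. -/
theorem add_side_eq (h : G.IsPotential φ y) {x z : X} (hxz : G.edge z = G.edge x) :
    φ z + φ (G.side z) = φ x + φ (G.side x) := by
  have key : ∀ w, φ (G.endSeg w) + φ (G.side (G.endSeg w)) = φ w + φ (G.side w) := fun w => by
    rw [← G.endSeg_side, h.2, h.2, G.edge_side]
    linear_combination CharTwo.add_self_eq_zero (y (G.edge w))
  rcases G.eq_of_edge_eq x z hxz with rfl | rfl | rfl | rfl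
  · rfl
  · exact key x
  · rw [G.side_side, add_comm]
  · rw [G.side_side, add_comm, key]

end IsPotential

theorem eq_of_edge_iterate_eq_of_lt {x : X} {i j k : ℕ} (hi : i < minimalPeriod G.next x)
    (hj : j < minimalPeriod G.next x) (hk : k < minimalPeriod G.next x)
    (hij : G.edge (G.next^[j] x) = G.edge (G.next^[i] x))
    (hik : G.edge (G.next^[k] x) = G.edge (G.next^[i] x)) : j = i ∨ k = i ∨ j = k := by
  have := G.eq_of_edge_iterate_eq hij hik
  rwa [iterate_eq_iterate_iff_of_lt_minimalPeriod hj hi,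
    iterate_eq_iterate_iff_of_lt_minimalPeriod hk hi,
    iterate_eq_iterate_iff_of_lt_minimalPeriod hj hk] at this

variable [Finite X]

/-- One direction of travel enters every ribbon a second time. -/
theorem Transitive.exists_edge_iterate_eq (hG : G.Transitive) (x : X) {i : ℕ}
    (hi : i < minimalPeriod G.next x) :
    ∃ j < minimalPeriod G.next x, j ≠ i ∧ G.edge (G.next^[j] x) = G.edge (G.next^[i] x) := by
  obtain ⟨k, hk0, hk, h⟩ := hG.exists_opposite (G.next^[i] x)
  have hp := G.next_injective.mem_periodicPts x
  rw [minimalPeriod_apply_iterate hp] at hk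
  refine ⟨(k + i) % minimalPeriod G.next x, Nat.mod_lt _ (G.minimalPeriod_next_pos x), ?_, ?_⟩
  · intro h'
    have : k ≡ 0 [MOD minimalPeriod G.next x] :=
      Nat.ModEq.add_right_cancel' i (by rw [zero_add, Nat.ModEq, h', Nat.mod_eq_of_lt hi])
    exact absurd (Nat.le_of_dvd hk0 ((Nat.modEq_zero_iff_dvd).1 this)) (by omega)
  · rw [iterate_mod_minimalPeriod_eq, iterate_add_apply]
    rcases h with h | h <;> rw [h] <;> simp [G.edge_side, G.edge_endSeg]

/-- The two visits to each ribbon are exchanged by a fixed-point-free involution, so the terms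
cancel in pairs. -/
theorem Transitive.sum_edge_iterate (hG : G.Transitive) (x : X) (y : E → ZMod 2) :
    ∑ s ∈ Finset.range (minimalPeriod G.next x), y (G.edge (G.next^[s] x)) = 0 := by
  choose g hg hne hedge using fun i hi => hG.exists_edge_iterate_eq (i := i) x hi
  refine Finset.sum_involution (fun i hi => g i (Finset.mem_range.1 hi)) (fun i hi => ?_)
    (fun i hi _ => hne i _) (fun i hi => Finset.mem_range.2 (hg i _)) fun i hi => ?_
  · rw [hedge]
    exact CharTwo.add_self_eq_zero _
  · have hi := Finset.mem_range.1 hi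
    rcases eq_of_edge_iterate_eq_of_lt (hg i hi) (hg _ (hg i hi)) hi (hedge _ _)
      (hedge i hi).symm with h | h | h
    · exact absurd h (hne _ _)
    · exact absurd h.symm (hne _ _)
    · exact h

/-- Integrate `y` along the walk from `x₀`; the vanishing total over one turn makes the result
single-valued. -/
theorem Transitive.exists_isPotential (hG : G.Transitive) (x₀ : X) (y : E → ZMod 2) :
    ∃ φ, G.IsPotential φ y ∧ φ x₀ = 0 := by
  choose pos hlt hpos using hG.exists_lt x₀
  have pos_iterate : ∀ i < minimalPeriod G.next x₀, pos (G.next^[i] x₀) = i := fun i hi => by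
    rcases hpos (G.next^[i] x₀) with h | h
    · exact ((iterate_eq_iterate_iff_of_lt_minimalPeriod hi (hlt _)).1 h).symm
    · exact absurd h.symm (G.arc_iterate_ne_iterate _ _ _)
  have pos_arc : ∀ z, pos (G.arc z) = pos z := fun z => by
    have : ∀ i < minimalPeriod G.next x₀, pos (G.arc (G.next^[i] x₀)) = i := fun i hi => by
      rcases hpos (G.arc (G.next^[i] x₀)) with h | h
      · exact absurd h (G.arc_iterate_ne_iterate _ _ _)
      · exact ((iterate_eq_iterate_iff_of_lt_minimalPeriod hi (hlt _)).1
          (Involutive.injective G.arc_arc h)).symm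
    rcases hpos z with h | h
    · conv_lhs => rw [h]
      rw [this _ (hlt _)]
    · conv_lhs => rw [h, G.arc_arc]
      rw [pos_iterate _ (hlt _)]
  let φ : X → ZMod 2 := fun z => ∑ s ∈ Finset.range (pos z), y (G.edge (G.next^[s] x₀))
  have hend : ∀ i < minimalPeriod G.next x₀,
      φ (G.endSeg (G.next^[i] x₀)) = φ (G.next^[i] x₀) + y (G.edge (G.next^[i] x₀)) := by
    intro i hi
    have : φ (G.next^[i] x₀) + y (G.edge (G.next^[i] x₀)) =
        ∑ s ∈ Finset.range (i + 1), y (G.edge (G.next^[s] x₀)) := by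
      simp only [φ, pos_iterate i hi, Finset.sum_range_succ]
    rw [this, ← G.arc_next, ← iterate_succ_apply' G.next]
    simp only [φ, pos_arc]
    rcases Nat.lt_or_ge (i + 1) (minimalPeriod G.next x₀) with h | h
    · rw [pos_iterate _ h]
    -- The turn closes: the position returns to 0, and the full sum vanishes.
    · obtain h : i + 1 = minimalPeriod G.next x₀ := by omega
      rw [Nat.succ_eq_add_one, h, hG.sum_edge_iterate, iterate_minimalPeriod,
        show pos x₀ = 0 from pos_iterate 0 (by omega), Finset.sum_range_zero]
  refine ⟨φ, ⟨fun x => by simp only [φ, pos_arc], fun x => ?_⟩, ?_⟩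
  · rcases hpos x with h | h
    · rw [h]
      exact hend _ (hlt _)
    -- Here the walk leaves an end at `x`, so the end is crossed backwards; the sign of the jump is
    -- immaterial mod 2.
    · obtain ⟨l, hl⟩ := G.exists_endSeg_arc_iterate (pos x) x₀
      rw [← h] at hl
      have := hend (l % minimalPeriod G.next x₀) (Nat.mod_lt _ (G.minimalPeriod_next_pos x₀))
      rw [iterate_mod_minimalPeriod_eq, hl, G.endSeg_endSeg, G.edge_endSeg] at this
      rw [this, add_assoc, CharTwo.add_self_eq_zero, add_zero]
  · simp [φ, show pos x₀ = 0 from pos_iterate 0 (G.minimalPeriod_next_pos x₀)]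

variable [DecidableEq E]

/-- Between its two entries into `e` the walk crosses `e` once, so `φ` differs by 1 there. If the
second entry is at `endSeg (side x)`, reaching `side x` costs another crossing and the difference
disappears. -/
theorem IsPotential.add_side_eq_one_iff_isNonorientableLoop (hG : G.Transitive)
    {φ : X → ZMod 2} {e : E} (h : G.IsPotential φ (Pi.single e 1)) {x : X} (hx : G.edge x = e) :
    φ x + φ (G.side x) = 1 ↔ G.IsNonorientableLoop e := by
  have step : ∀ z, G.edge z = e → ∀ k, 0 < k → k < minimalPeriod G.next z →
      G.edge (G.next^[k] z) = e → φ (G.next^[k] z) = φ z + 1 := by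
    intro z hz k hk0 hk hke
    rw [h.iterate, Finset.sum_eq_single 0]
    · simp [hz]
    · intro s hs hs0
      rw [Finset.mem_range] at hs
      refine Pi.single_eq_of_ne (fun hse => ?_) _
      rcases eq_of_edge_iterate_eq_of_lt (i := 0) (j := s) (k := k) (by omega) (hs.trans hk) hk
        (hse.trans hz.symm) (hke.trans hz.symm) with h | h | h <;> omega
    · simp [hk0.ne']
  constructor
  · intro h1
    obtain ⟨k, hk0, hk, hs | hs⟩ := hG.exists_opposite x
    · exact ⟨x, hx, k, hs⟩
    · have := step x hx k hk0 hk (by rw [hs, G.edge_endSeg, G.edge_side, hx])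
      rw [hs, h.2, G.edge_side, hx, Pi.single_eq_same] at this
      rw [add_right_cancel this, CharTwo.add_self_eq_zero] at h1
      exact absurd h1 (by decide)
  · rintro ⟨z, hz, k, hk⟩
    rw [h.add_side_eq (hx.trans hz.symm)]
    rw [← iterate_mod_minimalPeriod_eq] at hk
    have := step z hz _ (Nat.pos_of_ne_zero fun h0 => ?_)
      (Nat.mod_lt k (G.minimalPeriod_next_pos z)) (by rw [hk, G.edge_side, hz])
    · rw [hk] at this
      rw [this, ← add_assoc, CharTwo.add_self_eq_zero, zero_add]
    · rw [h0] at hk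
      exact G.side_ne z hk.symm

/-- Along the walk from one end of `e` to the other, `φ` counts the ends of `f` mod 2; the count is
odd exactly when one of the two ends of `f` lies in between. -/
theorem IsPotential.add_side_eq_one_iff_interlaced (hG : G.Transitive)
    {φ : X → ZMod 2} {e f : E} (hef : e ≠ f) (h : G.IsPotential φ (Pi.single f 1)) {x : X}
    (hx : G.edge x = e) :
    φ x + φ (G.side x) = 1 ↔ G.Interlaced e f := by
  have side_eq : ∀ z w, G.edge z = e → (w = G.side z ∨ w = G.endSeg (G.side z)) →
      φ (G.side z) = φ w := by
    rintro z w hz (rfl | rfl)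
    · rfl
    · rw [h.2, G.edge_side, hz, Pi.single_eq_of_ne hef, add_zero]
  constructor
  · intro h1
    obtain ⟨j, hj0, hj, hs⟩ := hG.exists_opposite x
    rw [side_eq x _ hx hs, h.iterate, ← add_assoc, CharTwo.add_self_eq_zero, zero_add] at h1
    obtain ⟨i, hi, hne⟩ := Finset.exists_ne_zero_of_sum_ne_zero (h1.trans_ne one_ne_zero)
    have hie : G.edge (G.next^[i] x) = f := by
      by_contra h'
      exact hne (Pi.single_eq_of_ne h' _)
    rw [Finset.mem_range] at hi
    obtain ⟨k, hk, hki, hke⟩ := hG.exists_edge_iterate_eq x (hi.trans hj)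
    have hje : G.edge (G.next^[j] x) = e := by
      rcases hs with hs | hs <;> rw [hs] <;> simp [G.edge_side, G.edge_endSeg, hx]
    refine ⟨x, i, j, k, Nat.pos_of_ne_zero ?_, hi, ?_, hk, hx, hie, hje, hke.trans hie⟩
    · rintro rfl
      exact hef (hx.symm.trans hie)
    · by_contra hkj
      obtain hkj | hkj := (not_lt.1 hkj).lt_or_eq
      -- Both ends of `f` would lie between those of `e`, making the sum even.
      · rw [← Finset.add_sum_erase _ _ (Finset.mem_range.2 hi), Finset.sum_eq_single k] at h1
        · rw [hke, hie, CharTwo.add_self_eq_zero] at h1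
          exact absurd h1 (by decide)
        · intro s hs hsk
          rw [Finset.mem_erase, Finset.mem_range] at hs
          refine Pi.single_eq_of_ne (fun hse => ?_) _
          rcases eq_of_edge_iterate_eq_of_lt (hi.trans hj) (hs.2.trans hj) hk
            (hse.trans hie.symm) hke with h | h | h <;> omega
        · intro hk'
          simp [hki, hkj] at hk'
      · subst hkj
        exact hef (hje.symm.trans (hke.trans hie))
  · rintro ⟨z, i, j, k, hi, hij, hjk, hk, hz, hie, hje, hke⟩
    rw [h.add_side_eq (hx.trans hz.symm)]
    have hs : G.next^[j] z = G.side z ∨ G.next^[j] z = G.endSeg (G.side z) := by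
      rcases G.edge_cases (hje.trans hz.symm) with (h' | h') | h'
      · exact absurd ((iterate_eq_iterate_iff_of_lt_minimalPeriod (n := 0) (hjk.trans hk)
          (by omega)).1 h') (by omega)
      · exact absurd h'.symm (G.endSeg_iterate_ne_iterate j 0 z)
      · exact h'
    rw [side_eq z _ hz hs, h.iterate, ← add_assoc, CharTwo.add_self_eq_zero, zero_add,
      Finset.sum_eq_single i]
    · rw [hie, Pi.single_eq_same]
    · intro s hs' hsi
      rw [Finset.mem_range] at hs'
      refine Pi.single_eq_of_ne (fun hse => ?_) _
      rcases eq_of_edge_iterate_eq_of_lt (i := i) (j := s) (k := k) (by omega) (by omega) hk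
        (hse.trans hie.symm) (hke.trans hie.symm) with h | h | h <;> omega
    · simp [hij]

theorem IsPotential.add_side_single (hG : G.Transitive) {φ : X → ZMod 2} {f : E}
    (h : G.IsPotential φ (Pi.single f 1)) (x : X) :
    φ x + φ (G.side x) =
      graftMatrix G.intersectionGraph {e | G.IsNonorientableLoop e} (G.edge x) f := by
  have key : ∀ (a : ZMod 2) (p : Prop) {_ : Decidable p}, (a = 1 ↔ p) → a = if p then 1 else 0 := by
    intro a p _ hp
    split_ifs with h'
    · exact hp.2 h'
    · have : a ≠ 1 := fun h => h' (hp.1 h)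
      revert this
      clear hp
      revert a
      decide
  rw [graftMatrix, Matrix.of_apply]
  refine key _ _ ?_
  by_cases hxf : G.edge x = f
  · rw [h.add_side_eq_one_iff_isNonorientableLoop hG hxf]
    simp [hxf]
  · rw [h.add_side_eq_one_iff_interlaced hG hxf rfl]
    simp [hxf, intersectionGraph]

/-- Both sides are linear in `y`, since the free additive constant of a potential drops out of the
left side; unit vectors give the columns of the matrix. -/
theorem IsPotential.add_side [Fintype E] (hG : G.Transitive) {φ : X → ZMod 2} {y : E → ZMod 2}
    (h : G.IsPotential φ y) (x : X) :
    φ x + φ (G.side x) =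
      (graftMatrix G.intersectionGraph {e | G.IsNonorientableLoop e}).mulVec y (G.edge x) := by
  choose ψ hψ _ using fun e : E => hG.exists_isPotential x (Pi.single e 1)
  have hsum := IsPotential.sum_smul hψ y
  have hy : ∑ e, y e • (Pi.single e 1 : E → ZMod 2) = y := by
    ext f
    simp [Finset.sum_apply, Pi.single_apply]
  rw [hy] at hsum
  have h0 := h.sub hsum
  rw [sub_self] at h0
  have hc := h0.eq_of_zero hG x (G.side x)
  have : φ x + φ (G.side x) = ∑ e, y e * (ψ e x + ψ e (G.side x)) := by
    simp only [Pi.sub_apply, Finset.sum_apply, Pi.smul_apply, smul_eq_mul] at hc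
    simp only [mul_add, Finset.sum_add_distrib]
    linear_combination hc + CharTwo.add_self_eq_zero (φ x) -
      CharTwo.add_self_eq_zero (∑ e, y e * ψ e x)
  rw [this, Matrix.mulVec, dotProduct]
  exact Finset.sum_congr rfl fun e _ => by rw [(hψ e).add_side_single hG, mul_comm]

end RibbonGraph

/-! ### Linear algebra of graft matrices and principal submatrices -/

theorem graftMatrix_symmDiff_mulVec {V : Type*} [Fintype V] [DecidableEq V] (H : SimpleGraph V)
    (L : Set V) (C : Finset V) (y : V → ZMod 2) (v : V) :
    (graftMatrix H (symmDiff L ↑C)).mulVec y v =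
      (graftMatrix H L).mulVec y v + if v ∈ C then y v else 0 := by
  have hM : graftMatrix H (symmDiff L ↑C) =
      graftMatrix H L + Matrix.diagonal fun v => if v ∈ C then 1 else 0 := by
    ext u w
    by_cases huw : u = w
    · subst huw
      by_cases h1 : u ∈ L <;> by_cases h2 : u ∈ C <;>
        simp [graftMatrix, Set.mem_symmDiff, h1, h2, CharTwo.add_self_eq_zero]
    · by_cases h : H.Adj u w <;> simp [graftMatrix, huw, h]
  rw [hM, Matrix.add_mulVec, Pi.add_apply, Matrix.mulVec_diagonal, ite_mul, one_mul, zero_mul]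

theorem principalSubmatrix_mulVec {V R : Type*} [Fintype V] [CommRing R] (M : Matrix V V R)
    (F : Finset V) {y : V → R} (hy : ∀ v ∉ F, y v = 0) (v : F) :
    (principalSubmatrix M F).mulVec (fun u => y u) v = M.mulVec y v := by
  simp only [Matrix.mulVec, dotProduct, principalSubmatrix, Matrix.submatrix_apply]
  rw [Finset.sum_coe_sort F fun u => M v u * y u]
  exact Finset.sum_subset (Finset.subset_univ _) fun u _ hu => by rw [hy u hu, mul_zero]

theorem rank_add_corank {V R : Type*} [Fintype V] [Field R] (M : Matrix V V R) :
    M.rank + corank M = Fintype.card V := by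
  rw [Matrix.rank, corank, LinearMap.finrank_range_add_finrank_ker,
    Module.finrank_fintype_fun_eq_card]

theorem rank_principalSubmatrix_univ {V R : Type*} [Fintype V] [CommRing R] (M : Matrix V V R) :
    (principalSubmatrix M Finset.univ).rank = M.rank :=
  Matrix.rank_submatrix M (Equiv.subtypeUnivEquiv Finset.mem_univ)
    (Equiv.subtypeUnivEquiv Finset.mem_univ)

/-- Functions on the classes of two maps are functions invariant under both. -/
def quotFunEquiv {X Y : Type*} (p q : X → X) :
    (Quot (fun x y : X => y = p x ∨ y = q x) → Y) ≃
      {f : X → Y // ∀ x, f (q x) = f x ∧ f (p x) = f x} where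
  toFun g := ⟨fun x => g (Quot.mk _ x), fun _ => ⟨congrArg g (Quot.sound (.inr rfl)).symm,
    congrArg g (Quot.sound (.inl rfl)).symm⟩⟩
  invFun f := Quot.lift f.1 (by
    rintro x y (rfl | rfl)
    exacts [(f.2 x).2.symm, (f.2 x).1.symm])
  left_inv g := by
    ext ⟨x⟩
    rfl
  right_inv f := rfl

/-! ### Counting closed curves -/

namespace RibbonGraph

variable {X E : Type*} (G : RibbonGraph X E)

/-- The pairing of corners that crosses the ends of the ribbons not in `F`, and follows the free
sides of the ribbons in `F`, after a half-twist of those in `C`. -/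
def pairing [DecidableEq E] (F C : Finset E) (x : X) : X :=
  if G.edge x ∈ F then if G.edge x ∈ C then G.side (G.endSeg x) else G.side x else G.endSeg x

/-- The number of closed curves formed by a pairing of the corners and the free arcs, with the
boundaries of the isolated vertices. -/
noncomputable def curveCount (p : X → X) : ℕ :=
  Nat.card (Quot (fun x y : X => y = p x ∨ y = G.arc x) ⊕ Fin G.isolated)

variable {G} [Finite X] [Fintype E] [DecidableEq E]

theorem IsPotential.pairing (hG : G.Transitive) (F C : Finset E) {φ : X → ZMod 2}
    {y : E → ZMod 2} (h : G.IsPotential φ y) (x : X) :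
    φ (G.pairing F C x) = φ x + if G.edge x ∈ F then
      (graftMatrix G.intersectionGraph (symmDiff {e | G.IsNonorientableLoop e} ↑C)).mulVec y
        (G.edge x) else y (G.edge x) := by
  rw [graftMatrix_symmDiff_mulVec, ← h.add_side hG, RibbonGraph.pairing]
  split_ifs
  · rw [← G.endSeg_side, h.2, G.edge_side]
    linear_combination -CharTwo.add_self_eq_zero (φ x)
  · linear_combination -CharTwo.add_self_eq_zero (φ x)
  · rw [h.2]

/-- A kernel vector, extended by zero, is integrated to the potential vanishing at `x₀`, and the
second factor is the value at `x₀`. Conversely the jumps of an invariant function give the vector.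
-/
theorem Transitive.exists_equiv_invariant (hG : G.Transitive) (x₀ : X) (F C : Finset E) :
    Nonempty (LinearMap.ker (principalSubmatrix (graftMatrix G.intersectionGraph
      (symmDiff {e | G.IsNonorientableLoop e} ↑C)) F).mulVecLin × ZMod 2 ≃
      {f : X → ZMod 2 // ∀ x, f (G.arc x) = f x ∧ f (G.pairing F C x) = f x}) := by
  set M := graftMatrix G.intersectionGraph (symmDiff {e | G.IsNonorientableLoop e} ↑C)
  let ext : (F → ZMod 2) → E → ZMod 2 := fun k e => if h : e ∈ F then k ⟨e, h⟩ else 0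
  have ext_zero : ∀ k, ∀ e ∉ F, ext k e = 0 := fun k e he => dif_neg he
  have ext_coe : ∀ k, (fun e : F => ext k e) = k := fun k => funext fun e => dif_pos e.2
  choose φ hφ hφ0 using fun k : F → ZMod 2 => hG.exists_isPotential x₀ (ext k)
  have hinv : ∀ k ∈ LinearMap.ker (principalSubmatrix M F).mulVecLin, ∀ x,
      φ k (G.pairing F C x) = φ k x := by
    intro k hk x
    rw [(hφ k).pairing hG, add_eq_left]
    split_ifs with hx
    · have := congrFun (LinearMap.mem_ker.1 hk) ⟨_, hx⟩
      rwa [Matrix.mulVecLin_apply, ← ext_coe k,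
        principalSubmatrix_mulVec M F (ext_zero k)] at this
    · exact ext_zero k _ hx
  refine ⟨Equiv.ofBijective (fun kc => ⟨fun x => φ kc.1.1 x + kc.2, fun x =>
    ⟨congrArg (· + kc.2) ((hφ _).1 x), congrArg (· + kc.2) (hinv _ kc.1.2 x)⟩⟩) ⟨?_, ?_⟩⟩
  · rintro ⟨⟨k, hk⟩, c⟩ ⟨⟨l, hl⟩, d⟩ h
    have h : ∀ x, φ k x + c = φ l x + d := congrFun (congrArg Subtype.val h)
    obtain rfl : c = d := by simpa [hφ0] using h x₀
    obtain rfl : k = l := by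
      rw [← ext_coe k, ← ext_coe l]
      funext e
      obtain ⟨x, hx⟩ := G.edge_surjective e
      have h1 := h (G.endSeg x)
      rw [(hφ k).2, (hφ l).2, hx] at h1
      linear_combination h1 - h x
    rfl
  · rintro ⟨f, hf⟩
    choose c hc using G.edge_surjective
    let y : E → ZMod 2 := fun e => f (G.endSeg (c e)) - f (c e)
    have hend : ∀ x, G.edge x ∉ F → f (G.endSeg x) = f x := fun x hx => by
      have := (hf x).2
      rwa [RibbonGraph.pairing, if_neg hx] at this
    have hy0 : ∀ e ∉ F, y e = 0 := fun e he => by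
      simp only [y, hend (c e) (by rwa [hc]), sub_self]
    have hfy : G.IsPotential f y := by
      refine ⟨fun x => (hf x).1, fun x => ?_⟩
      rw [← sub_eq_iff_eq_add']
      simp only [y]
      -- Invariance along the free sides forces equal jumps at the two ends; with a half-twist they
      -- are opposite, which is the same mod 2.
      have hs : G.edge x ∈ F → f (G.endSeg (G.side x)) - f (G.side x) =
          f (G.endSeg x) - f x := fun hx => by
        have h1 := (hf x).2
        have h2 := (hf (G.endSeg x)).2
        rw [RibbonGraph.pairing] at h1 h2
        rw [G.edge_endSeg] at h2
        rw [if_pos hx] at h1 h2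
        split_ifs at h1 h2
        · rw [G.endSeg_endSeg] at h2
          rw [G.endSeg_side, h1, h2]
          linear_combination CharTwo.add_self_eq_zero (f x) -
            CharTwo.add_self_eq_zero (f (G.endSeg x))
        · rw [G.endSeg_side, h1, h2]
      by_cases hx : G.edge x ∈ F
      · have hneg : ∀ z, f (G.endSeg (G.endSeg z)) - f (G.endSeg z) =
            f (G.endSeg z) - f z := fun z => by
          rw [G.endSeg_endSeg]
          linear_combination CharTwo.add_self_eq_zero (f z) -
            CharTwo.add_self_eq_zero (f (G.endSeg z))
        rcases G.edge_cases (hc (G.edge x)) with (h | h) | (h | h) <;> rw [h]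
        · rw [hneg]
        · rw [hs hx]
        · rw [hneg, hs hx]
      · rw [hend x hx, hend (c _) (by rwa [hc]), sub_self, sub_self]
    have hyext : ext (fun e : F => y e) = y := by
      funext e
      by_cases he : e ∈ F
      · exact dif_pos he
      · exact (dif_neg he).trans (hy0 e he).symm
    refine ⟨⟨⟨fun e => y e, ?_⟩, f x₀⟩, ?_⟩
    · rw [LinearMap.mem_ker]
      funext e
      rw [Matrix.mulVecLin_apply, principalSubmatrix_mulVec M F hy0]
      obtain ⟨x, hx⟩ := G.edge_surjective e.1
      have := hfy.pairing hG F C x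
      rwa [(hf x).2, left_eq_add, hx, if_pos e.2] at this
    · apply Subtype.ext
      funext x
      have h0 := hfy.sub (hφ fun e : F => y e)
      rw [hyext, sub_self] at h0
      have := h0.eq_of_zero hG x₀ x
      simp only [Pi.sub_apply, hφ0] at this
      change φ _ x + f x₀ = f x
      linear_combination -this

/-- The Cohn–Lempel formula: the number of closed curves is the corank of a matrix, plus one. -/
theorem IsBouquet.curveCount_pairing (hG : G.IsBouquet) (F C : Finset E) :
    G.curveCount (G.pairing F C) + (principalSubmatrix (graftMatrix G.intersectionGraph
      (symmDiff {e | G.IsNonorientableLoop e} ↑C)) F).rank = F.card + 1 := by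
  set M := principalSubmatrix (graftMatrix G.intersectionGraph
      (symmDiff {e | G.IsNonorientableLoop e} ↑C)) F
  have hrank := rank_add_corank M
  rw [Fintype.card_coe] at hrank
  rw [← hrank, add_assoc, add_comm, Nat.add_left_cancel_iff]
  cases isEmpty_or_nonempty X with
  | inl hX =>
    -- Without corners there is just one isolated disc, whose boundary is the only curve.
    have : IsEmpty E := ⟨fun e => (G.edge_surjective e).elim fun x _ => hX.elim x⟩
    have h1 : Nat.card (Fin G.isolated) = 1 := by
      rw [← hG, Vertex, Nat.card_sum, Nat.card_of_isEmpty (α := Quot _), zero_add]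
    rw [curveCount, Nat.card_sum, h1, Nat.card_of_isEmpty (α := Quot _), zero_add]
    have := Finset.card_eq_zero.2 (Finset.eq_empty_of_isEmpty F)
    omega
  | inr hX =>
    obtain ⟨x₀⟩ := hX
    have hiso : G.isolated = 0 := by
      have h1 : Nat.card G.Vertex = 1 := hG
      have : 0 < Nat.card (Quot fun x y : X => y = G.endSeg x ∨ y = G.arc x) :=
        Nat.card_pos_iff.2 ⟨⟨Quot.mk _ x₀⟩, inferInstance⟩
      rw [Vertex, Nat.card_sum, Nat.card_fin] at h1
      omega
    obtain ⟨Φ⟩ := (G.transitive_of_isBouquet hG).exists_equiv_invariant x₀ F C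
    -- Counting invariant functions both ways equates two powers of 2, with exponents corank plus
    -- one and the number of curves.
    have hcard := Nat.card_congr (Φ.trans (quotFunEquiv (Y := ZMod 2) (G.pairing F C) G.arc).symm)
    rw [Nat.card_prod, Nat.card_fun, Module.natCard_eq_pow_finrank (K := ZMod 2), Nat.card_zmod,
      ← pow_succ] at hcard
    rw [curveCount, Nat.card_sum, hiso, Nat.card_fin, add_zero]
    exact (Nat.pow_right_injective le_rfl hcard).symm

theorem IsBouquet.eulerGenus_eq (hG : G.IsBouquet) (H : RibbonGraph X E)
    (hi : H.isolated = G.isolated) (ha : H.arc = G.arc)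
    (hedge : H.edge = G.edge) {F C F' C' : Finset E}
    (hend : H.endSeg = G.pairing F C) (hside : H.side = G.pairing F' C') :
    H.eulerGenus = Fintype.card E +
      (principalSubmatrix (graftMatrix G.intersectionGraph
        (symmDiff {e | G.IsNonorientableLoop e} ↑C)) F).rank - F.card +
      (principalSubmatrix (graftMatrix G.intersectionGraph
        (symmDiff {e | G.IsNonorientableLoop e} ↑C')) F').rank - F'.card := by
  have hv : (Nat.card H.Vertex : ℤ) = F.card + 1 - (principalSubmatrix
      (graftMatrix G.intersectionGraph (symmDiff {e | G.IsNonorientableLoop e} ↑C)) F).rank := by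
    rw [Vertex, hi, ha, hend]
    have := hG.curveCount_pairing F C
    rw [curveCount] at this
    omega
  have hf : (Nat.card H.BoundaryComponent : ℤ) = F'.card + 1 - (principalSubmatrix
      (graftMatrix G.intersectionGraph (symmDiff {e | G.IsNonorientableLoop e} ↑C')) F').rank := by
    rw [BoundaryComponent, hi, ha, hside]
    have := hG.curveCount_pairing F' C'
    rw [curveCount] at this
    omega
  have hc : Nat.card H.Component = 1 := by
    obtain ⟨hsub, hne⟩ := Nat.card_eq_one_iff_unique.1 (show Nat.card G.Vertex = 1 from hG)
    -- `H` has the ribbons and arcs of `G`, and all corners of a ribbon share a component, so the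
    -- single vertex of `G` maps onto the components of `H`.
    have hmk : ∀ x y, G.edge y = G.edge x →
        (Quot.mk (fun x y : X => y = H.endSeg x ∨ y = H.side x ∨ y = H.arc x) x) =
          Quot.mk _ y := by
      intro x y hxy
      rw [← hedge] at hxy
      rcases H.eq_of_edge_eq x y hxy with rfl | rfl | rfl | rfl
      · rfl
      · exact Quot.sound (.inl rfl)
      · exact Quot.sound (.inr (.inl rfl))
      · exact (Quot.sound (.inl rfl)).trans (Quot.sound (.inr (.inl rfl)))
    let g : G.Vertex → H.Component := Sum.map (Quot.lift (Quot.mk _) (by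
      rintro x y (rfl | rfl)
      · exact hmk _ _ (G.edge_endSeg x)
      · exact Quot.sound (.inr (.inr (by rw [ha]))))) (Fin.cast hi.symm)
    have hg : Surjective g := by
      rintro (⟨⟨x⟩⟩ | i)
      · exact ⟨.inl (Quot.mk _ x), rfl⟩
      · exact ⟨.inr (Fin.cast hi i), rfl⟩
    exact Nat.card_eq_one_iff_unique.2 ⟨hg.subsingleton, hne.map g⟩
  rw [eulerGenus, eulerChar, hc, hv, hf, Nat.card_eq_fintype_card]
  push_cast
  ring

end RibbonGraph

/-! ### The five Euler genus formulas -/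

open RibbonGraph.TwualLetter in
theorem theorem2p2 {X E : Type*} [Finite X] [Fintype E] [DecidableEq E]
    (B : RibbonGraph X E) (hB : B.IsBouquet)
    (S : Set E) (hS : S = {e | B.IsNonorientableLoop e}) (F : Finset E) :
    (B.twual [τ] F).eulerGenus =
        ((graftMatrix B.intersectionGraph (symmDiff S ↑F)).rank : ℤ) ∧
    (B.twual [δ] F).eulerGenus =
        ((principalSubmatrix (graftMatrix B.intersectionGraph S) F).rank : ℤ) +
          ((principalSubmatrix (graftMatrix B.intersectionGraph S) Fᶜ).rank : ℤ) ∧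
    (B.twual [δ, τ] F).eulerGenus =
        ((principalSubmatrix (graftMatrix B.intersectionGraph (symmDiff S ↑F)) F).rank : ℤ) +
          ((principalSubmatrix (graftMatrix B.intersectionGraph S) Fᶜ).rank : ℤ) ∧
    (B.twual [τ, δ] F).eulerGenus =
        ((graftMatrix B.intersectionGraph (symmDiff S ↑F)).rank : ℤ) -
          (corank (principalSubmatrix (graftMatrix B.intersectionGraph S) F) : ℤ) ∧
    (B.twual [τ, δ, τ] F).eulerGenus =
        ((graftMatrix B.intersectionGraph S).rank : ℤ) -
          (corank (principalSubmatrix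
            (graftMatrix B.intersectionGraph (symmDiff S ↑F)) F) : ℤ) := by
  subst hS
  have hcompl : (F.card : ℤ) + (Fᶜ.card : ℤ) = Fintype.card E := by
    exact_mod_cast Finset.card_add_card_compl F
  have hco := fun M : Matrix E E (ZMod 2) => rank_add_corank (principalSubmatrix M F)
  simp only [Fintype.card_coe] at hco
  have hempty : ∀ M : Matrix E E (ZMod 2), (principalSubmatrix M ∅).rank = 0 := fun M => by
    have := rank_add_corank (principalSubmatrix M ∅)
    rw [Fintype.card_coe, Finset.card_empty] at this
    omega
  have hS : symmDiff {e | B.IsNonorientableLoop e} ↑(∅ : Finset E) =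
      {e | B.IsNonorientableLoop e} := by
    rw [Finset.coe_empty]
    exact symmDiff_bot _
  refine ⟨?_, ?_, ?_, ?_, ?_⟩
  · rw [hB.eulerGenus_eq (B.twual [τ] F) rfl rfl rfl (F := ∅) (C := ∅) (F' := Finset.univ)
      (C' := F) (by funext x; simp [RibbonGraph.twual, RibbonGraph.partialPetrial,
        RibbonGraph.pairing]) (by funext x; by_cases h : B.edge x ∈ F <;> simp [RibbonGraph.twual,
        RibbonGraph.partialPetrial, RibbonGraph.pairing, h]), rank_principalSubmatrix_univ, hempty, Finset.card_univ,
      Finset.card_empty]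
    push_cast
    ring
  · rw [hB.eulerGenus_eq (B.twual [δ] F) rfl rfl rfl (F := F) (C := ∅) (F' := Fᶜ)
      (C' := ∅) (by funext x; by_cases h : B.edge x ∈ F <;>
          simp [RibbonGraph.twual, RibbonGraph.partialDual, RibbonGraph.pairing, h]) (by funext x; by_cases h : B.edge x ∈ F <;>
          simp [RibbonGraph.twual, RibbonGraph.partialDual, RibbonGraph.pairing, h]), hS]
    linear_combination -hcompl
  · rw [hB.eulerGenus_eq (B.twual [δ, τ] F) rfl rfl rfl (F := F) (C := F) (F' := Fᶜ)
      (C' := ∅) (by funext x; by_cases h : B.edge x ∈ F <;>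
          simp [RibbonGraph.twual, RibbonGraph.partialDual, RibbonGraph.partialPetrial,
            RibbonGraph.pairing, h])
        (by funext x; by_cases h : B.edge x ∈ F <;>
          simp [RibbonGraph.twual, RibbonGraph.partialDual, RibbonGraph.partialPetrial,
            RibbonGraph.pairing, h]), hS]
    linear_combination -hcompl
  -- On `F` the dual exchanges ends and sides, and the later twist composes them: boundary curves
  -- follow twisted sides on `F` and plain sides elsewhere.
  · rw [hB.eulerGenus_eq (B.twual [τ, δ] F) rfl rfl rfl (F := F) (C := ∅) (F' := Finset.univ)
      (C' := F) (by funext x; by_cases h : B.edge x ∈ F <;>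
          simp [RibbonGraph.twual, RibbonGraph.partialDual, RibbonGraph.partialPetrial,
            RibbonGraph.pairing, h])
        (by funext x; by_cases h : B.edge x ∈ F <;>
          simp [RibbonGraph.twual, RibbonGraph.partialDual, RibbonGraph.partialPetrial,
            RibbonGraph.pairing, B.edge_side, B.endSeg_side, h]), hS, rank_principalSubmatrix_univ,
      Finset.card_univ, ← hco (graftMatrix B.intersectionGraph {e | B.IsNonorientableLoop e})]
    push_cast
    ring
  -- The second twist composes the twisted side with `endSeg`, restoring the original free side, so
  -- the boundary curves are those of `B`.
  · rw [hB.eulerGenus_eq (B.twual [τ, δ, τ] F) rfl rfl rfl (F := F) (C := F) (F' := Finset.univ)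
      (C' := ∅) (by funext x; by_cases h : B.edge x ∈ F <;>
          simp [RibbonGraph.twual, RibbonGraph.partialDual, RibbonGraph.partialPetrial,
            RibbonGraph.pairing, h])
        (by funext x; by_cases h : B.edge x ∈ F <;>
          simp [RibbonGraph.twual, RibbonGraph.partialDual, RibbonGraph.partialPetrial,
            RibbonGraph.pairing, B.endSeg_side, B.endSeg_endSeg, B.edge_side, B.edge_endSeg, h]),
      hS, rank_principalSubmatrix_univ, Finset.card_univ,
      ← hco (graftMatrix B.intersectionGraph (symmDiff {e | B.IsNonorientableLoop e} ↑F))]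
    push_cast
    ring
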